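/- A topological graph is a graph drawn in the plane: its vertices are distinct points, its edges are non-self-intersecting curves joining the corresponding points, no edge passes through a vertex other than its endpoints, and two edges that share an interior point properly cross there. It is simple if any two edges have at most one point in common. Two edges cross if they share a point that is not a vertex. A plane cycle is a cycle of the graph (of any length $k\ge 3$) no two of whose edges cross; the face it encloses (a face generated by the graph) is the bounded connected component of the complement of the closed curve it draws. Theorem. For every $n\ge 1$ there is a complete simple topological graph $D_n$ with vertices $v_1,\dots,v_n$, drawn in the unit square $[0,1]\times[0,1]$, such that every face generated by $D_n$ has area at least $\frac{1}{3n}$; in particular, every such face has area $\Omega(1/n)$. Moreover, $D_n$ can be chosen with the following properties. (i) For $i_1<i_2$ and $i_3<i_4$, the edges $v_{i_1}v_{i_2}$ and $v_{i_3}v_{i_4}$ cross if and only if $i_1<i_3<i_2<i_4$ or $i_3<i_1<i_4<i_2$. (ii) Every plane cycle in $D_n$ visits its vertices in increasing order: it can be written as $v_{i_1}\to v_{i_2}\to\dots\to v_{i_k}\to v_{i_1}$ with $i_1<i_2<\dots<i_k$, up to the choice of the starting vertex and the orientation. (iii) There are pairwise disjoint closed axis-parallel rectangles $R_1,\dots,R_n$,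 each of area $\frac{1}{3n}$, such that the face enclosed by any plane cycle $v_{i_1}\to\dots\to v_{i_k}\to v_{i_1}$ with $i_1<\dots<i_k$ contains $R_{i_2},\dots,R_{i_{k-1}}$. -/

import Mathlib

open Set MeasureTheory

/-- `A` is a non-self-intersecting curve in the plane with endpoints `p` and `q`:
the image of an injective continuous path from `p` to `q`. -/
def IsArc (A : Set (ℝ × ℝ)) (p q : ℝ × ℝ) : Prop :=
  ∃ γ : Path p q, Function.Injective γ ∧ Set.range γ = A

/-- The curves `A` and `B` properly cross at the point `x`: near `x`, the pair `(A, B)` looks, up to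
a homeomorphism, like the two coordinate axes near the origin. -/
def ProperCrossingAt (A B : Set (ℝ × ℝ)) (x : ℝ × ℝ) : Prop :=
  ∃ φ : OpenPartialHomeomorph (ℝ × ℝ) (ℝ × ℝ),
    x ∈ φ.source ∧ φ x = (0, 0) ∧
      ∀ y ∈ φ.source, (y ∈ A ↔ (φ y).2 = 0) ∧ (y ∈ B ↔ (φ y).1 = 0)

/-- A topological graph: a drawing of the graph `G` in the plane. Vertices are distinct points, each
edge is a non-self-intersecting curve joining the points of its two ends, no curve passes through a
vertex other than its endpoints, and two edges that share an interior point properly cross there. -/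
structure TopologicalGraph {V : Type*} (G : SimpleGraph V) where
  /-- the point that represents a vertex -/
  point : V → ℝ × ℝ
  /-- the curve that represents an edge (only the values on edges of `G` matter) -/
  curve : Sym2 V → Set (ℝ × ℝ)
  point_injective : Function.Injective point
  isArc_curve : ∀ u v : V, G.Adj u v → IsArc (curve s(u, v)) (point u) (point v)
  mem_of_point_mem_curve : ∀ e ∈ G.edgeSet, ∀ w : V, point w ∈ curve e → w ∈ e
  properCrossingAt : ∀ e ∈ G.edgeSet, ∀ f ∈ G.edgeSet, e ≠ f →
    ∀ x ∈ curve e ∩ curve f, x ∉ Set.range point → ProperCrossingAt (curve e) (curve f) x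

namespace TopologicalGraph

variable {V : Type*} {G : SimpleGraph V} (D : TopologicalGraph G)

/-- The topological graph is simple: any two edges intersect at most once. (By the definition of a
topological graph the intersection is then a common endpoint or a proper crossing.) -/
def IsSimple : Prop :=
  ∀ e ∈ G.edgeSet, ∀ f ∈ G.edgeSet, e ≠ f → (D.curve e ∩ D.curve f).Subsingleton

/-- The drawing lies in the unit square `[0,1] × [0,1]`. -/
def InUnitSquare : Prop :=
  (∀ v : V, D.point v ∈ Icc (0 : ℝ) 1 ×ˢ Icc (0 : ℝ) 1) ∧
    ∀ e ∈ G.edgeSet, D.curve e ⊆ Icc (0 : ℝ) 1 ×ˢ Icc (0 : ℝ) 1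

/-- Two distinct edges cross: their curves have a common point that is not a vertex. -/
def Cross (e f : Sym2 V) : Prop :=
  e ≠ f ∧ ∃ x ∈ D.curve e ∩ D.curve f, x ∉ Set.range D.point

/-- A closed walk that is a cycle of the graph and whose edges are pairwise non-crossing. -/
def IsPlaneCycle {v : V} (c : G.Walk v v) : Prop :=
  c.IsCycle ∧ ∀ e ∈ c.edges, ∀ f ∈ c.edges, ¬ D.Cross e f

/-- The closed curve in the plane that is drawn by a closed walk. -/
def trace {v : V} (c : G.Walk v v) : Set (ℝ × ℝ) :=
  ⋃ e ∈ c.edges, D.curve e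

/-- `F` is the face enclosed by the plane cycle `c`: the bounded cell cut out by `c`, that is, the
bounded connected component of the complement of the closed curve `D.trace c`. -/
def IsFaceOf {v : V} (c : G.Walk v v) (F : Set (ℝ × ℝ)) : Prop :=
  D.IsPlaneCycle c ∧ Bornology.IsBounded F ∧
    ∃ x ∈ (D.trace c)ᶜ, F = connectedComponentIn (D.trace c)ᶜ x

/-- `F` is a face generated by the topological graph: it is enclosed by some plane cycle. -/
def GeneratesFace (F : Set (ℝ × ℝ)) : Prop :=
  ∃ (v : V) (c : G.Walk v v), D.IsFaceOf c F

end TopologicalGraph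

/-- A closed (nondegenerate, axis-parallel) rectangle in the plane. -/
def IsClosedRectangle (R : Set (ℝ × ℝ)) : Prop :=
  ∃ a b c d : ℝ, a < b ∧ c < d ∧ R = Icc a b ×ˢ Icc c d

/-- The closed walk `c` visits its vertices in increasing order: up to the choice of its starting
vertex and of its orientation, the list of the vertices that it visits is strictly increasing. -/
def VisitsInIncreasingOrder {n : ℕ} {G : SimpleGraph (Fin n)} {v : Fin n} (c : G.Walk v v) : Prop :=
  ∃ l : List (Fin n), l.Pairwise (· < ·) ∧
    (l.IsRotated c.support.tail ∨ l.reverse.IsRotated c.support.tail)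

/-!
Put the vertices on the parabola `y = x ^ 2` and draw the edges as straight segments. Two edges
cross exactly if their ends alternate, so a plane cycle is the boundary of a convex polygon
traversed in order, and the face that it encloses is the interior of the polygon. If `k` is
neither the first nor the last vertex of the cycle, this interior contains the pocket of `k`: the
points below all chords that pass over `k` and above all other chords. It remains to deform the
plane so that the drawing fits into the unit square and each pocket contains a rectangle of area
`1 / (3 * n)`.

At `(x, x ^ 2 + t)` the chord between the abscissas `a` and `b` has the height `(x - a) * (b - x)`
over the parabola. If consecutive abscissas are more than `1` apart, then over an interval around
the `k`-th one the chords that pass over `k` have height at least `1`, and those that end in `k`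
have height at most the half-width of the interval times the spread of all abscissas. A staircase
that stretches the unit interval to length about `n`, but only between the vertices, leaves
intervals of half-width `1 / (3 * n)`, over which the pockets contain all heights between `1 / 3`
and `1`.
-/

section Transport

variable (h : (ℝ × ℝ) ≃ₜ (ℝ × ℝ)) {A B : Set (ℝ × ℝ)} {x p q : ℝ × ℝ}

theorem IsArc.preimage_homeomorph (hA : IsArc A p q) :
    IsArc (h ⁻¹' A) (h.symm p) (h.symm q) := by
  obtain ⟨γ, hγ, rfl⟩ := hA
  refine ⟨γ.map h.symm.continuous, h.symm.injective.comp hγ, ?_⟩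
  rw [← h.image_symm, ← range_comp]
  rfl

theorem ProperCrossingAt.preimage_homeomorph (hAB : ProperCrossingAt A B (h x)) :
    ProperCrossingAt (h ⁻¹' A) (h ⁻¹' B) x := by
  obtain ⟨φ, hx, hφx, hφ⟩ := hAB
  exact ⟨h.transOpenPartialHomeomorph φ, hx, hφx, fun y hy => hφ (h y) hy⟩

namespace TopologicalGraph

variable {V : Type*} {G : SimpleGraph V} (D : TopologicalGraph G)

/-- The drawing whose image under the homeomorphism `h` of the plane is the drawing `D`. -/
def comap : TopologicalGraph G where
  point v := h.symm (D.point v)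
  curve e := h ⁻¹' D.curve e
  point_injective := h.symm.injective.comp D.point_injective
  isArc_curve u v huv := (D.isArc_curve u v huv).preimage_homeomorph h
  mem_of_point_mem_curve e he w hw := D.mem_of_point_mem_curve e he w (by simpa using hw)
  properCrossingAt e he f hf hef x hx hxv :=
    (D.properCrossingAt e he f hf hef (h x) hx fun ⟨v, hv⟩ =>
      hxv ⟨v, by simp [hv]⟩).preimage_homeomorph h

variable {h D}

theorem mem_range_comap_point : x ∈ range (D.comap h).point ↔ h x ∈ range D.point := by
  simp only [mem_range, comap, h.symm_apply_eq]

theorem IsSimple.comap (hD : D.IsSimple) : (D.comap h).IsSimple :=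
  fun e he f hf hef => (hD e he f hf hef).preimage h.injective

theorem cross_comap {e f : Sym2 V} : (D.comap h).Cross e f ↔ D.Cross e f := by
  refine and_congr_right fun _ => ⟨?_, ?_⟩
  · rintro ⟨x, hx, hxv⟩
    exact ⟨h x, hx, mem_range_comap_point.not.1 hxv⟩
  · rintro ⟨y, hy, hyv⟩
    refine ⟨h.symm y, ?_, mem_range_comap_point.not.2 (by simpa using hyv)⟩
    simpa [comap] using hy

variable {v : V} {c : G.Walk v v}

theorem isPlaneCycle_comap : (D.comap h).IsPlaneCycle c ↔ D.IsPlaneCycle c := by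
  simp only [IsPlaneCycle, cross_comap]

theorem trace_comap : (D.comap h).trace c = h ⁻¹' D.trace c := by
  simp only [trace, comap, preimage_iUnion]

theorem IsFaceOf.image {F : Set (ℝ × ℝ)} (hF : (D.comap h).IsFaceOf c F) :
    D.IsFaceOf c (h '' F) := by
  obtain ⟨hc, hbdd, x, hx, rfl⟩ := hF
  refine ⟨isPlaneCycle_comap.1 hc, ?_, h x, by simpa [trace_comap] using hx, ?_⟩
  · exact (hbdd.isCompact_closure.image h.continuous).isBounded.subset (image_mono subset_closure)
  · rw [h.image_connectedComponentIn hx, image_compl_eq h.bijective, trace_comap,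
      image_preimage_eq _ h.surjective]

end TopologicalGraph

end Transport

section Convex

variable {E : Type*} [NormedAddCommGroup E] [NormedSpace ℝ E] {K C S : Set E} {p : E}

theorem not_isBounded_connectedComponentIn_compl_of_convex (hK : Convex ℝ K) (hne : K.Nonempty)
    (hp : p ∉ K) (hS : S ⊆ K) : ¬ Bornology.IsBounded (connectedComponentIn Sᶜ p) := by
  obtain ⟨b, hb⟩ := hne
  set ray : Set E := AffineMap.lineMap b p '' Ici (1 : ℝ)
  have hray : ray ⊆ Sᶜ := by
    rintro _ ⟨t, ht, rfl⟩ hmem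
    have ht0 : 0 < t := one_pos.trans_le ht
    refine hp ?_
    convert hK.lineMap_mem hb (hS hmem) ⟨inv_nonneg.2 ht0.le, inv_le_one_of_one_le₀ ht⟩
    simp [AffineMap.lineMap_apply, ht0.ne']
  have hconn : IsPreconnected ray :=
    isPreconnected_Ici.image _ AffineMap.lineMap_continuous.continuousOn
  have hsub : ray ⊆ connectedComponentIn Sᶜ p :=
    hconn.subset_connectedComponentIn ⟨1, self_mem_Ici, AffineMap.lineMap_apply_one b p⟩ hray
  intro hbdd
  obtain ⟨r, hr⟩ := (hbdd.subset hsub).subset_closedBall b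
  have hd : 0 < dist b p := dist_pos.2 fun h => hp (h ▸ hb)
  set t := max 1 ((r + 1) / dist b p)
  have ht1 : 1 ≤ t := le_max_left _ _
  have ht : t * dist b p ≤ r := by
    have hmem := hr ⟨t, ht1, rfl⟩
    rwa [Metric.mem_closedBall, dist_lineMap_left, Real.norm_of_nonneg (by positivity)] at hmem
  have ht' : r + 1 ≤ t * dist b p := (div_le_iff₀ hd).1 (le_max_right _ _)
  linarith

theorem subset_connectedComponentIn_compl_diff_of_convex (hK : Convex ℝ K) (hC : Convex ℝ C)
    (hCK : C ⊆ K) (hp : p ∉ K \ C)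
    (hbdd : Bornology.IsBounded (connectedComponentIn (K \ C)ᶜ p)) :
    C ⊆ connectedComponentIn (K \ C)ᶜ p := by
  rcases C.eq_empty_or_nonempty with rfl | hne
  · exact empty_subset _
  have hpK : p ∈ K := by
    by_contra hpK
    exact not_isBounded_connectedComponentIn_compl_of_convex hK (hne.mono hCK) hpK sdiff_subset hbdd
  have hpC : p ∈ C := by_contra fun hpC => hp ⟨hpK, hpC⟩
  exact hC.isPreconnected.subset_connectedComponentIn hpC fun q hq hqKC => hqKC.2 hq

end Convex

section Crossing

variable {A B U : Set (ℝ × ℝ)} {m₁ k₁ m₂ k₂ : ℝ} {p : ℝ × ℝ}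

/-- The coordinate system of the plane whose axes are the lines `y = m₁ * x - k₁` (second coordinate
zero) and `y = m₂ * x - k₂` (first coordinate zero), which are not parallel. -/
noncomputable def lineCoordinates (m₁ k₁ m₂ k₂ : ℝ) (h : m₁ ≠ m₂) : (ℝ × ℝ) ≃ₜ (ℝ × ℝ) where
  toFun p := (p.2 - (m₂ * p.1 - k₂), p.2 - (m₁ * p.1 - k₁))
  invFun q :=
    ((q.1 - q.2 + (k₁ - k₂)) / (m₁ - m₂), (m₁ * q.1 - m₂ * q.2 + (m₂ * k₁ - m₁ * k₂)) / (m₁ - m₂))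
  left_inv p := by
    have hne : m₁ - m₂ ≠ 0 := sub_ne_zero.2 h
    ext <;> simp only <;> field_simp <;> ring
  right_inv q := by
    have hne : m₁ - m₂ ≠ 0 := sub_ne_zero.2 h
    ext <;> simp only <;> field_simp <;> ring
  continuous_toFun := by fun_prop
  continuous_invFun := by fun_prop

theorem properCrossingAt_of_lines (hne : m₁ ≠ m₂) (hU : IsOpen U) (hpU : p ∈ U)
    (hA : ∀ q ∈ U, q ∈ A ↔ q.2 = m₁ * q.1 - k₁) (hB : ∀ q ∈ U, q ∈ B ↔ q.2 = m₂ * q.1 - k₂)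
    (hp : p ∈ A ∩ B) : ProperCrossingAt A B p := by
  refine ⟨(lineCoordinates m₁ k₁ m₂ k₂ hne).toOpenPartialHomeomorph.restrOpen U hU, by simpa,
    Prod.ext ?_ ?_, fun q hq => ?_⟩
  · exact sub_eq_zero.2 ((hB p hpU).1 hp.2)
  · exact sub_eq_zero.2 ((hA p hpU).1 hp.1)
  · have hqU : q ∈ U := by simpa using hq
    exact ⟨(hA q hqU).trans sub_eq_zero.symm, (hB q hqU).trans sub_eq_zero.symm⟩

end Crossing

section Chord

theorem isArc_graphOn_uIcc {f : ℝ → ℝ} (hf : Continuous f) {a b : ℝ} (hab : a ≠ b) :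
    IsArc ((uIcc a b).graphOn f) (a, f a) (b, f b) := by
  refine ⟨(Path.segment a b).map (continuous_id.prodMk hf), fun s t hst => ?_, ?_⟩
  · exact Path.segment_injective_of_ne hab (congrArg Prod.fst hst)
  · rw [Path.map_coe, range_comp, Path.range_segment, segment_eq_uIcc]
    rfl

theorem sym2_mk_eq_of_add_eq_of_mul_eq {R : Type*} [CommRing R] [NoZeroDivisors R] {a b c d : R}
    (hadd : a + b = c + d) (hmul : a * b = c * d) : s(a, b) = s(c, d) := by
  obtain rfl : b = c + d - a := eq_sub_of_add_eq' hadd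
  have h : (a - c) * (a - d) = 0 := by linear_combination -hmul
  rcases mul_eq_zero.1 h with h | h <;> simp [sub_eq_zero.1 h, Sym2.eq_swap]

variable {a b c d x : ℝ} {p : ℝ × ℝ}

/-- The function whose graph is the line through the points of abscissas `a` and `b` of the parabola
`y = x ^ 2`, the tangent if `a = b`. -/
def chordLine (a b x : ℝ) : ℝ := (a + b) * x - a * b

theorem chordLine_comm (a b : ℝ) : chordLine a b = chordLine b a := by
  ext x
  simp only [chordLine]
  ring

theorem chordLine_eq (a b x : ℝ) : chordLine a b x = x ^ 2 + (x - a) * (b - x) := by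
  simp only [chordLine]
  ring

theorem chordLine_left_self (a b : ℝ) : chordLine a b a = a ^ 2 := by
  simp [chordLine_eq]

theorem chordLine_right_self (a b : ℝ) : chordLine a b b = b ^ 2 := by
  simp [chordLine_eq]

theorem chordLine_sub_chordLine (a b c x : ℝ) :
    chordLine a c x - chordLine a b x = (c - b) * (x - a) := by
  simp only [chordLine]
  ring

theorem continuous_chordLine (a b : ℝ) : Continuous (chordLine a b) := by
  unfold chordLine
  fun_prop

theorem sq_lt_chordLine_iff (hab : a ≤ b) : x ^ 2 < chordLine a b x ↔ x ∈ Ioo a b := by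
  rw [chordLine_eq, lt_add_iff_pos_right, mem_Ioo]
  refine ⟨fun h => ?_, fun h => mul_pos (sub_pos.2 h.1) (sub_pos.2 h.2)⟩
  constructor <;> by_contra! <;> nlinarith

theorem sq_le_chordLine_iff (hab : a ≤ b) : x ^ 2 ≤ chordLine a b x ↔ x ∈ Icc a b := by
  rw [chordLine_eq, le_add_iff_nonneg_right, mem_Icc]
  refine ⟨fun h => ?_, fun h => mul_nonneg (sub_nonneg.2 h.1) (sub_nonneg.2 h.2)⟩
  constructor <;> by_contra! <;> nlinarith

theorem chordLine_sub_chordLine_mul (a b c d x : ℝ) :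
    (chordLine c d x - chordLine a b x) * (d - c) =
      (d - x) * ((a - c) * (b - c)) + (x - c) * ((d - a) * (d - b)) := by
  simp only [chordLine]
  ring

theorem chordLine_lt_chordLine (hca : c ≤ a) (hab : a ≤ b) (hbd : b ≤ d) (hne : c < a ∨ b < d)
    (hx : x ∈ Ioo c d) : chordLine a b x < chordLine c d x := by
  have hcx := sub_pos.2 hx.1
  have hxd := sub_pos.2 hx.2
  have hpos : 0 < (chordLine c d x - chordLine a b x) * (d - c) := by
    rw [chordLine_sub_chordLine_mul]
    have hl : 0 ≤ (a - c) * (b - c) := mul_nonneg (by linarith) (by linarith)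
    have hr : 0 ≤ (d - a) * (d - b) := mul_nonneg (by linarith) (by linarith)
    rcases hne with h | h
    · have : 0 < (a - c) * (b - c) := mul_pos (by linarith) (by linarith)
      positivity
    · have : 0 < (d - a) * (d - b) := mul_pos (by linarith) (by linarith)
      positivity
  exact sub_pos.1 (pos_of_mul_pos_left hpos (by linarith))

theorem chordLine_le_chordLine (hca : c ≤ a) (hab : a ≤ b) (hbd : b ≤ d) (hx : x ∈ Icc c d) :
    chordLine a b x ≤ chordLine c d x := by
  rcases (hx.1.trans hx.2).eq_or_lt with rfl | hcd
  · obtain rfl : a = c := by linarith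
    obtain rfl : b = a := by linarith
    rfl
  have hnonneg : 0 ≤ (chordLine c d x - chordLine a b x) * (d - c) := by
    rw [chordLine_sub_chordLine_mul]
    have hl : 0 ≤ (a - c) * (b - c) := mul_nonneg (by linarith) (by linarith)
    have hr : 0 ≤ (d - a) * (d - b) := mul_nonneg (by linarith) (by linarith)
    exact add_nonneg (mul_nonneg (sub_nonneg.2 hx.2) hl) (mul_nonneg (sub_nonneg.2 hx.1) hr)
  exact sub_nonneg.1 (nonneg_of_mul_nonneg_left hnonneg (sub_pos.2 hcd))

theorem exists_chordLine_eq_chordLine (hab : a < b) (hbc : b < c) (hcd : c < d) :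
    ∃ x ∈ Ioo b c, chordLine a c x = chordLine b d x := by
  have hb : chordLine b d b < chordLine a c b := by
    rw [chordLine_left_self]
    exact (sq_lt_chordLine_iff (hab.trans hbc).le).2 ⟨hab, hbc⟩
  have hc : chordLine a c c < chordLine b d c := by
    rw [chordLine_right_self]
    exact (sq_lt_chordLine_iff (hbc.trans hcd).le).2 ⟨hbc, hcd⟩
  obtain ⟨x, hx, hxeq⟩ := isPreconnected_Icc.intermediate_value₂ (left_mem_Icc.2 hbc.le)
    (right_mem_Icc.2 hbc.le) (continuous_chordLine b d).continuousOn
    (continuous_chordLine a c).continuousOn hb.le hc.le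
  exact ⟨x, ⟨hx.1.lt_of_ne fun h => hb.ne (h ▸ hxeq), hx.2.lt_of_ne fun h => hc.ne' (h ▸ hxeq)⟩,
    hxeq.symm⟩

theorem sym2_mk_eq_of_chordLine_eq (hsum : a + b = c + d)
    (h : chordLine a b x = chordLine c d x) : s(a, b) = s(c, d) := by
  refine sym2_mk_eq_of_add_eq_of_mul_eq hsum ?_
  simp only [chordLine, hsum] at h
  linarith

/-- The straight segment that joins the points of abscissas `a` and `b` of the parabola
`y = x ^ 2`. -/
def chord (a b : ℝ) : Set (ℝ × ℝ) := (uIcc a b).graphOn (chordLine a b)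

theorem chord_comm (a b : ℝ) : chord a b = chord b a := by
  rw [chord, chord, uIcc_comm, chordLine_comm]

theorem isArc_chord (hab : a ≠ b) : IsArc (chord a b) (a, a ^ 2) (b, b ^ 2) := by
  simpa only [chord, chordLine_left_self, chordLine_right_self] using
    isArc_graphOn_uIcc (continuous_chordLine a b) hab

theorem mem_chord : p ∈ chord a b ↔ p.1 ^ 2 ≤ p.2 ∧ p.2 = chordLine a b p.1 := by
  wlog hab : a ≤ b generalizing a b
  · rw [chord_comm, chordLine_comm, this (le_of_not_ge hab)]
  simp only [chord, mem_graphOn, uIcc_of_le hab, ← sq_le_chordLine_iff hab]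
  grind

theorem mem_Ioo_of_mem_chord (hab : a ≤ b) (hp : p ∈ chord a b) (hlt : p.1 ^ 2 < p.2) :
    p.1 ∈ Ioo a b :=
  (sq_lt_chordLine_iff hab).1 ((mem_chord.1 hp).2 ▸ hlt)

theorem fst_eq_or_of_mem_chord (hp : p ∈ chord a b) (heq : p.2 = p.1 ^ 2) :
    p.1 = a ∨ p.1 = b := by
  have h := (mem_chord.1 hp).2
  rw [heq, chordLine_eq, left_eq_add, mul_eq_zero, sub_eq_zero, sub_eq_zero] at h
  exact h.imp_right Eq.symm

theorem subsingleton_chord_inter_chord (hne : s(a, b) ≠ s(c, d)) :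
    (chord a b ∩ chord c d).Subsingleton := by
  intro p hp q hq
  obtain ⟨⟨-, hpab⟩, -, hpcd⟩ := hp.imp mem_chord.1 mem_chord.1
  obtain ⟨⟨-, hqab⟩, -, hqcd⟩ := hq.imp mem_chord.1 mem_chord.1
  have hslope : a + b - (c + d) ≠ 0 := fun h =>
    hne (sym2_mk_eq_of_chordLine_eq (sub_eq_zero.1 h) (hpab.symm.trans hpcd))
  have hfst : p.1 = q.1 := by
    refine mul_left_cancel₀ hslope ?_
    simp only [chordLine] at hpab hpcd hqab hqcd
    linarith
  exact Prod.ext hfst (by rw [hpab, hqab, hfst])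

theorem alternate_of_mem_chord_inter_chord (hab : a < b) (hcd : c < d) (hne : s(a, b) ≠ s(c, d))
    (hp : p ∈ chord a b ∩ chord c d) (hlt : p.1 ^ 2 < p.2) :
    (a < c ∧ c < b ∧ b < d) ∨ (c < a ∧ a < d ∧ d < b) := by
  have hxab := mem_Ioo_of_mem_chord hab.le hp.1 hlt
  have hxcd := mem_Ioo_of_mem_chord hcd.le hp.2 hlt
  have heq : chordLine a b p.1 = chordLine c d p.1 :=
    (mem_chord.1 hp.1).2.symm.trans (mem_chord.1 hp.2).2
  have hout (h : a ≤ c ∧ d ≤ b) : ¬ (a < c ∨ d < b) := fun h' =>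
    heq.not_gt (chordLine_lt_chordLine h.1 hcd.le h.2 h' hxab)
  have hin (h : c ≤ a ∧ b ≤ d) : ¬ (c < a ∨ b < d) := fun h' =>
    heq.not_lt (chordLine_lt_chordLine h.1 hab.le h.2 h' hxcd)
  have hcb := hxcd.1.trans hxab.2
  have had := hxab.1.trans hxcd.2
  grind

theorem properCrossingAt_chord (hne : s(a, b) ≠ s(c, d)) (hp : p ∈ chord a b ∩ chord c d)
    (hlt : p.1 ^ 2 < p.2) : ProperCrossingAt (chord a b) (chord c d) p := by
  have hslope : a + b ≠ c + d := fun h => hne <|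
    sym2_mk_eq_of_chordLine_eq h ((mem_chord.1 hp.1).2.symm.trans (mem_chord.1 hp.2).2)
  have hmem (u v : ℝ) : ∀ q ∈ {q : ℝ × ℝ | q.1 ^ 2 < q.2}, q ∈ chord u v ↔
      q.2 = (u + v) * q.1 - u * v := fun q hq =>
    mem_chord.trans (and_iff_right hq.le)
  have hopen : IsOpen {q : ℝ × ℝ | q.1 ^ 2 < q.2} := isOpen_lt (by fun_prop) (by fun_prop)
  exact properCrossingAt_of_lines hslope hopen hlt (hmem a b) (hmem c d) hp

end Chord

section ChordDrawing

variable {V : Type*} {a : V → ℝ} {ha : Function.Injective a} {p : ℝ × ℝ}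

theorem sq_lt_of_mem_chord_of_notMem_range {v w : V} (hp : p ∈ chord (a v) (a w))
    (hpv : p ∉ range fun u => (a u, a u ^ 2)) : p.1 ^ 2 < p.2 := by
  refine (mem_chord.1 hp).1.lt_of_ne' fun h => hpv ?_
  rcases fst_eq_or_of_mem_chord hp h with h' | h'
  · exact ⟨v, by ext <;> simp [← h', h]⟩
  · exact ⟨w, by ext <;> simp [← h', h]⟩

/-- The drawing of the complete graph on points of the parabola `y = x ^ 2`, in which every edge is
drawn as a straight segment. -/
def chordDrawing (a : V → ℝ) (ha : Function.Injective a) :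
    TopologicalGraph (⊤ : SimpleGraph V) where
  point v := (a v, a v ^ 2)
  curve := Sym2.lift ⟨fun v w => chord (a v) (a w), fun _ _ => chord_comm _ _⟩
  point_injective v w h := ha (congrArg Prod.fst h)
  isArc_curve v w h := isArc_chord (ha.ne h.ne)
  mem_of_point_mem_curve e _ w := by
    induction e with | _ i j
    intro h
    rcases fst_eq_or_of_mem_chord h rfl with h | h
    · exact ha h ▸ Sym2.mem_mk_left _ _
    · exact ha h ▸ Sym2.mem_mk_right _ _
  properCrossingAt e _ f _ hef p hp hpv := by
    induction e with | _ i j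
    induction f with | _ k l
    exact properCrossingAt_chord (fun h => hef (Sym2.map.injective ha h)) hp
      (sq_lt_of_mem_chord_of_notMem_range hp.1 hpv)

@[simp] theorem chordDrawing_curve (v w : V) :
    (chordDrawing a ha).curve s(v, w) = chord (a v) (a w) := rfl

theorem isSimple_chordDrawing : (chordDrawing a ha).IsSimple := by
  intro e _ f _ hef
  induction e with | _ i j
  induction f with | _ k l
  exact subsingleton_chord_inter_chord fun h => hef (Sym2.map.injective ha h)

theorem cross_chordDrawing_iff [LinearOrder V] (hmono : StrictMono a) {i j k l : V} (hij : i < j)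
    (hkl : k < l) : (chordDrawing a ha).Cross s(i, j) s(k, l) ↔
      (i < k ∧ k < j ∧ j < l) ∨ (k < i ∧ i < l ∧ l < j) := by
  simp only [TopologicalGraph.Cross, chordDrawing_curve]
  refine ⟨?_, fun h => ⟨by grind, ?_⟩⟩
  · rintro ⟨hne, p, hp, hpv⟩
    simpa only [hmono.lt_iff_lt] using alternate_of_mem_chord_inter_chord (hmono hij) (hmono hkl)
      (fun h => hne (Sym2.map.injective ha h)) hp (sq_lt_of_mem_chord_of_notMem_range hp.1 hpv)
  · have hcross {i j k l : V} (hik : i < k) (hkj : k < j) (hjl : j < l) :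
        ∃ p ∈ chord (a i) (a j) ∩ chord (a k) (a l), p ∉ range (chordDrawing a ha).point := by
      obtain ⟨x, hx, hxeq⟩ :=
        exists_chordLine_eq_chordLine (hmono hik) (hmono hkj) (hmono hjl)
      have hlt : x ^ 2 < chordLine (a i) (a j) x :=
        (sq_lt_chordLine_iff (hmono (hik.trans hkj)).le).2 ⟨(hmono hik).trans hx.1, hx.2⟩
      refine ⟨(x, chordLine (a i) (a j) x), ⟨mem_chord.2 ⟨hlt.le, rfl⟩,
        mem_chord.2 ⟨hlt.le, hxeq⟩⟩, ?_⟩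
      rintro ⟨v, hv⟩
      obtain ⟨rfl, hv⟩ := Prod.ext_iff.1 hv
      exact hlt.ne hv
    rcases h with ⟨h₁, h₂, h₃⟩ | ⟨h₁, h₂, h₃⟩
    · exact hcross h₁ h₂ h₃
    · obtain ⟨p, hp, hpv⟩ := hcross h₁ h₂ h₃
      exact ⟨p, hp.symm, hpv⟩

end ChordDrawing

section NoncrossingCycle

variable {α : Type*} [LinearOrder α]

/-- No two pairs in `E` alternate in the linear order `α`. For points in convex position, numbered
along the convex hull, this says that the chords in `E` are pairwise noncrossing. -/
def Noncrossing (E : Set (Sym2 α)) : Prop :=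
  ∀ ⦃a x b y : α⦄, a < x → x < b → b < y → s(a, b) ∈ E → s(x, y) ∉ E

theorem strictMonoOn_of_noncrossing {E : Set (Sym2 α)} (hE : Noncrossing E) {w : ℕ → α} {m : ℕ}
    (hinj : InjOn w (Iic m)) (hedge : ∀ i < m, s(w i, w (i + 1)) ∈ E) (hclose : s(w 0, w m) ∈ E)
    (hmin : ∀ i ≤ m, w 0 ≤ w i) (hlast : w 1 ≤ w m) : StrictMonoOn w (Iic m) := by
  have hne {i j : ℕ} (hi : i ≤ m) (hj : j ≤ m) (hij : i ≠ j) : w i ≠ w j := hinj.ne hi hj hij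
  have hpos {i : ℕ} (hi : 0 < i) (him : i ≤ m) : w 0 < w i :=
    (hmin i him).lt_of_ne (hne m.zero_le him hi.ne)
  -- Once the cycle enters the gap between `w i` and `w (i + 1)`, it cannot leave it any more, so it
  -- cannot return to `w 0`.
  have hlt (i : ℕ) : ∀ j, i < j → j ≤ m → w i < w j := by
    induction i with
    | zero => exact fun j hj hjm => hpos hj hjm
    | succ i ih =>
      intro j hij hjm
      by_contra! hle
      have hstay (l : ℕ) (hjl : j ≤ l) : l ≤ m → w l ∈ Ioo (w i) (w (i + 1)) := by
        induction l, hjl using Nat.le_induction with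
        | base => exact fun _ => ⟨ih j (by omega) hjm, hle.lt_of_ne (hne hjm (by omega) (by omega))⟩
        | succ l hjl ihl =>
          intro hlm
          obtain ⟨hil, hli⟩ := ihl (by omega)
          refine ⟨ih (l + 1) (by omega) hlm, lt_of_not_ge fun hge => ?_⟩
          exact hE hil hli (hge.lt_of_ne (hne (by omega) hlm (by omega))) (hedge i (by omega))
            (hedge l (by omega))
      obtain ⟨him, hmi⟩ := hstay m hjm le_rfl
      rcases i.eq_zero_or_pos with rfl | hi
      · exact hmi.not_ge hlast
      · exact hE (hpos hi (by omega)) him hmi hclose (hedge i (by omega))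
  exact fun i _ j hj hij => hlt i j hij hj

variable {G : SimpleGraph α} {u v : α} {c : G.Walk v v} {d : G.Walk u u}

/-- The closed walk `d` is the closed walk `c` up to the choice of the starting vertex and of the
orientation. -/
def Retraces (d : G.Walk u u) (c : G.Walk v v) : Prop :=
  ∃ hu : u ∈ c.support, d = c.rotate u hu ∨ d = (c.rotate u hu).reverse

namespace Retraces

theorem mem_edges_iff (h : Retraces d c) {e : Sym2 α} : e ∈ d.edges ↔ e ∈ c.edges := by
  obtain ⟨hu, rfl | rfl⟩ := h <;> simp [(c.rotate_edges u hu).mem_iff]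

theorem mem_support_iff (h : Retraces d c) {w : α} : w ∈ d.support ↔ w ∈ c.support := by
  obtain ⟨hu, rfl | rfl⟩ := h <;> simp

theorem isCycle (h : Retraces d c) (hc : c.IsCycle) : d.IsCycle := by
  obtain ⟨hu, rfl | rfl⟩ := h
  · exact hc.rotate hu
  · exact (hc.rotate hu).reverse

theorem trace_eq (h : Retraces d c) (D : TopologicalGraph G) : D.trace d = D.trace c := by
  simp only [TopologicalGraph.trace, h.mem_edges_iff]

theorem isRotated_or_reverse_isRotated (h : Retraces d c) :
    d.support.dropLast.IsRotated c.support.tail ∨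
      d.support.dropLast.reverse.IsRotated c.support.tail := by
  obtain ⟨hu, rfl | rfl⟩ := h
  · refine .inl (.trans ?_ (c.support_rotate u hu))
    generalize c.rotate u hu = d
    obtain ⟨l, hl⟩ : ∃ l, d.support = l ++ [u] := ⟨_, d.dropLast_support_concat.symm⟩
    cases l with
    | nil => simp [hl]
    | cons x t =>
      obtain rfl : x = u := by simpa [hl] using d.cons_tail_support.symm
      rw [hl, List.dropLast_concat]
      exact (List.isRotated_concat x t).symm
  · right
    simpa only [SimpleGraph.Walk.support_reverse, List.dropLast_reverse, List.reverse_reverse]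
      using c.support_rotate u hu

theorem visitsInIncreasingOrder {n : ℕ} {G : SimpleGraph (Fin n)} {u v : Fin n} {c : G.Walk v v}
    {d : G.Walk u u} (h : Retraces d c) (hd : StrictMonoOn d.getVert (Iic (d.length - 1))) :
    VisitsInIncreasingOrder c := by
  refine ⟨d.support.dropLast, List.pairwise_iff_getElem.2 fun i j hi hj hij => ?_,
    h.isRotated_or_reverse_isRotated⟩
  simp only [List.length_dropLast, SimpleGraph.Walk.length_support] at hi hj
  simp only [List.getElem_dropLast, SimpleGraph.Walk.support_getElem_eq_getVert]
  exact hd (by grind) (by grind) hij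

end Retraces

theorem strictMonoOn_getVert_of_noncrossing (hd : d.IsCycle) (hE : Noncrossing {e | e ∈ d.edges})
    (hmin : ∀ w ∈ d.support, u ≤ w) (hlast : d.snd ≤ d.penultimate) :
    StrictMonoOn d.getVert (Iic (d.length - 1)) := by
  refine strictMonoOn_of_noncrossing hE hd.getVert_injOn' (fun i hi => ?_) ?_ (fun i _ => ?_) hlast
  · exact d.mk_mem_edges_iff_exists.2 ⟨i, by omega, rfl⟩
  · simpa [Sym2.eq_swap] using d.mk_penultimate_end_mem_edges hd.not_nil
  · simpa using hmin _ (d.getVert_mem_support i)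

theorem exists_retraces_strictMonoOn (hc : c.IsCycle) (hE : Noncrossing {e | e ∈ c.edges}) :
    ∃ (u : α) (d : G.Walk u u), Retraces d c ∧ StrictMonoOn d.getVert (Iic (d.length - 1)) := by
  obtain ⟨u, hu, hmin⟩ := c.support.toFinset.exists_min_image id
    ⟨v, List.mem_toFinset.2 c.start_mem_support⟩
  simp only [List.mem_toFinset, id] at hu hmin
  obtain ⟨d, hd, hlast⟩ : ∃ d : G.Walk u u, Retraces d c ∧ d.snd ≤ d.penultimate := by
    rcases le_total (c.rotate u hu).snd (c.rotate u hu).penultimate with h | h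
    · exact ⟨_, ⟨hu, .inl rfl⟩, h⟩
    · exact ⟨_, ⟨hu, .inr rfl⟩, by simpa using h⟩
  refine ⟨u, d, hd, strictMonoOn_getVert_of_noncrossing (hd.isCycle hc) ?_ ?_ hlast⟩
  · simpa only [hd.mem_edges_iff] using hE
  · simpa only [hd.mem_support_iff] using hmin

end NoncrossingCycle

section Polygon

variable {s : ℕ → ℝ} {m : ℕ} {p : ℝ × ℝ}

/-- The closed convex polygon whose vertices are the points of abscissas `s 0 < s 1 < ⋯ < s m` of
the parabola `y = x ^ 2`. -/
def closedPolygon (s : ℕ → ℝ) (m : ℕ) : Set (ℝ × ℝ) :=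
  {p | p.2 ≤ chordLine (s 0) (s m) p.1 ∧ ∀ i < m, chordLine (s i) (s (i + 1)) p.1 ≤ p.2}

/-- The interior of `closedPolygon s m`. -/
def openPolygon (s : ℕ → ℝ) (m : ℕ) : Set (ℝ × ℝ) :=
  {p | p.2 < chordLine (s 0) (s m) p.1 ∧ ∀ i < m, chordLine (s i) (s (i + 1)) p.1 < p.2}

theorem convex_setOf_sub_chordLine_mem (a b : ℝ) {I : Set ℝ} (hI : Convex ℝ I) :
    Convex ℝ {p : ℝ × ℝ | p.2 - chordLine a b p.1 ∈ I} := by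
  intro p hp q hq t r ht hr htr
  change _ - _ ∈ I
  convert hI hp hq ht hr htr using 1
  simp only [chordLine, Prod.snd_add, Prod.smul_snd, Prod.fst_add, Prod.smul_fst, smul_eq_mul]
  linear_combination -(a * b) * htr

theorem convex_closedPolygon : Convex ℝ (closedPolygon s m) := by
  convert (convex_setOf_sub_chordLine_mem (s 0) (s m) (convex_Iic 0)).inter
    (convex_iInter₂ fun i (_ : i < m) =>
      convex_setOf_sub_chordLine_mem (s i) (s (i + 1)) (convex_Ici 0)) using 1
  ext p
  simp [closedPolygon]

theorem convex_openPolygon : Convex ℝ (openPolygon s m) := by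
  convert (convex_setOf_sub_chordLine_mem (s 0) (s m) (convex_Iio 0)).inter
    (convex_iInter₂ fun i (_ : i < m) =>
      convex_setOf_sub_chordLine_mem (s i) (s (i + 1)) (convex_Ioi 0)) using 1
  ext p
  simp [openPolygon]

theorem openPolygon_subset_closedPolygon : openPolygon s m ⊆ closedPolygon s m :=
  fun _ hp => ⟨hp.1.le, fun i hi => (hp.2 i hi).le⟩

theorem exists_mem_Icc_succ {α : Type*} [LinearOrder α] {s : ℕ → α} {m : ℕ} (hm : 1 ≤ m) {x : α}
    (hx : x ∈ Icc (s 0) (s m)) : ∃ i < m, x ∈ Icc (s i) (s (i + 1)) := by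
  induction m, hm using Nat.le_induction with
  | base => exact ⟨0, one_pos, hx⟩
  | succ m _ ih =>
    rcases le_total x (s m) with h | h
    · obtain ⟨i, hi, hxi⟩ := ih ⟨hx.1, h⟩
      exact ⟨i, hi.trans m.lt_succ_self, hxi⟩
    · exact ⟨m, m.lt_succ_self, h, hx.2⟩

theorem sq_le_of_mem_closedPolygon (hm : 2 ≤ m) (hs : StrictMonoOn s (Iic m))
    (hp : p ∈ closedPolygon s m) : p.1 ^ 2 ≤ p.2 := by
  obtain ⟨l, rfl⟩ : ∃ l, m = l + 1 := ⟨m - 1, by omega⟩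
  have hleft : s 0 ≤ p.1 := by
    have hlt : s 1 < s (l + 1) := hs (by grind) (by grind) (by omega)
    have h := (hp.2 0 (by omega)).trans hp.1
    rw [← sub_nonneg, chordLine_sub_chordLine] at h
    exact sub_nonneg.1 (nonneg_of_mul_nonneg_right h (sub_pos.2 hlt))
  have hright : p.1 ≤ s (l + 1) := by
    have hlt : s 0 < s l := hs (by grind) (by grind) (by omega)
    have h := (hp.2 l (by omega)).trans hp.1
    rw [chordLine_comm, chordLine_comm (s 0), ← sub_nonneg, chordLine_sub_chordLine] at h
    exact sub_nonpos.1 (nonpos_of_mul_nonneg_right h (sub_neg.2 hlt))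
  obtain ⟨i, hi, hxi⟩ := exists_mem_Icc_succ (by omega) ⟨hleft, hright⟩
  have hle : s i ≤ s (i + 1) := hxi.1.trans hxi.2
  exact ((sq_le_chordLine_iff hle).2 hxi).trans (hp.2 i hi)

theorem closedPolygon_sdiff_openPolygon (hm : 2 ≤ m) (hs : StrictMonoOn s (Iic m)) :
    closedPolygon s m \ openPolygon s m =
      chord (s 0) (s m) ∪ ⋃ i < m, chord (s i) (s (i + 1)) := by
  have hle {i j : ℕ} (hij : i ≤ j) (hj : j ≤ m) : s i ≤ s j :=
    hs.monotoneOn (hij.trans hj) hj hij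
  ext p
  simp only [mem_union, mem_iUnion, exists_prop, mem_chord]
  constructor
  · rintro ⟨hp, hpo⟩
    have hsq := sq_le_of_mem_closedPolygon hm hs hp
    by_contra! h
    exact hpo ⟨hp.1.lt_of_ne (h.1 hsq), fun i hi => (hp.2 i hi).lt_of_ne' (h.2 i hi hsq)⟩
  · rintro (⟨hsq, hy⟩ | ⟨i, hi, hsq, hy⟩)
    · have hx := (sq_le_chordLine_iff (hle m.zero_le le_rfl)).1 (hy ▸ hsq)
      refine ⟨⟨hy.le, fun i hi => hy ▸ ?_⟩, fun h => h.1.ne hy⟩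
      exact chordLine_le_chordLine (hle i.zero_le hi.le) (hle i.le_succ hi) (hle hi le_rfl) hx
    · have hx := (sq_le_chordLine_iff (hle i.le_succ hi)).1 (hy ▸ hsq)
      have h0 := hle i.zero_le hi.le
      have hm := hle hi le_rfl
      refine ⟨⟨hy.trans_le ?_, fun j hj => ?_⟩, fun h => (h.2 i hi).ne' hy⟩
      · exact chordLine_le_chordLine h0 (hle i.le_succ hi) hm ⟨h0.trans hx.1, hx.2.trans hm⟩
      · rcases eq_or_ne j i with rfl | hji
        · exact hy.ge
        refine le_trans (le_of_not_gt fun h => ?_) hsq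
        obtain ⟨hjx, hxj⟩ := (sq_lt_chordLine_iff (hle j.le_succ hj)).1 h
        rcases hji.lt_or_gt with hlt | hlt
        · exact hxj.not_ge ((hle hlt hi.le).trans hx.1)
        · exact hjx.not_ge (hx.2.trans (hle hlt hj.le))

end Polygon

section ClosedWalk

variable {V : Type*} {G : SimpleGraph V} {u v : V} {d : G.Walk u u}

theorem mem_support_iff_exists_getVert_le :
    v ∈ d.support ↔ ∃ j ≤ d.length - 1, d.getVert j = v := by
  rw [SimpleGraph.Walk.mem_support_iff_exists_getVert]
  constructor
  · rintro ⟨j, rfl, hj⟩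
    rcases hj.eq_or_lt with rfl | hj
    · exact ⟨0, Nat.zero_le _, by simp⟩
    · exact ⟨j, by omega, rfl⟩
  · rintro ⟨j, hj, rfl⟩
    exact ⟨j, rfl, by omega⟩

theorem mem_edges_iff_eq_or_exists_getVert (hd : ¬ d.Nil) {e : Sym2 V} :
    e ∈ d.edges ↔ e = s(d.getVert 0, d.getVert (d.length - 1)) ∨
      ∃ i < d.length - 1, e = s(d.getVert i, d.getVert (i + 1)) := by
  have hpos : 0 < d.length := SimpleGraph.Walk.not_nil_iff_lt_length.1 hd
  induction e with | _ x y
  rw [d.mk_mem_edges_iff_exists]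
  constructor
  · rintro ⟨i, hi, h⟩
    rcases (Nat.le_sub_one_of_lt hi).eq_or_lt with rfl | hi
    · left
      simp [← h, Nat.sub_add_cancel hpos, Sym2.eq_swap]
    · exact .inr ⟨i, hi, h.symm⟩
  · rintro (h | ⟨i, hi, h⟩)
    · exact ⟨d.length - 1, by omega, by simp [h, Nat.sub_add_cancel hpos, Sym2.eq_swap]⟩
    · exact ⟨i, by omega, h.symm⟩

theorem trace_eq_union_iUnion (D : TopologicalGraph G) (hd : ¬ d.Nil) :
    D.trace d = D.curve s(d.getVert 0, d.getVert (d.length - 1)) ∪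
      ⋃ i < d.length - 1, D.curve s(d.getVert i, d.getVert (i + 1)) := by
  ext p
  simp only [TopologicalGraph.trace, mem_iUnion, mem_union, mem_edges_iff_eq_or_exists_getVert hd]
  grind

end ClosedWalk

section Pocket

variable {V : Type*} [LinearOrder V] {a : V → ℝ} {ha : Function.Injective a}
  {k u v : V} {c : (⊤ : SimpleGraph V).Walk v v} {d : (⊤ : SimpleGraph V).Walk u u}

/-- The points below all chords that pass over the vertex `k` and above all other chords, for the
vertices of abscissas `a` on the parabola `y = x ^ 2`. -/
def pocket (a : V → ℝ) (k : V) : Set (ℝ × ℝ) :=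
  {p | (∀ i j, i < k → k < j → p.2 < chordLine (a i) (a j) p.1) ∧
    ∀ i j, i < j → k ≤ i ∨ j ≤ k → chordLine (a i) (a j) p.1 < p.2}

theorem mem_pocket (hmono : Monotone a) {x t δ L : ℝ} (hleft : ∀ i < k, a i + 1 ≤ x)
    (hright : ∀ j > k, x + 1 ≤ a j) (hx : |x - a k| ≤ δ) (hL : ∀ i j, a j - a i ≤ L)
    (hδL : δ * L < t) (ht : t < 1) : (x, x ^ 2 + t) ∈ pocket a k := by
  have hδ : 0 ≤ δ := (abs_nonneg _).trans hx
  have ht0 : 0 < t := (mul_nonneg hδ ((sub_self (a k)).symm.trans_le (hL k k))).trans_lt hδL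
  obtain ⟨hxl, hxr⟩ := abs_le.1 hx
  have hspread (i j : V) : δ * (a j - a i) < t :=
    (mul_le_mul_of_nonneg_left (hL i j) hδ).trans_lt hδL
  refine ⟨fun i j hik hkj => ?_, fun i j hij hk => ?_⟩
  · rw [chordLine_eq, add_lt_add_iff_left]
    have hi : 1 ≤ x - a i := by linarith [hleft i hik]
    have hj : 1 ≤ a j - x := by linarith [hright j hkj]
    exact ht.trans_le (one_le_mul_of_one_le_of_one_le hi hj)
  · rw [chordLine_eq, add_lt_add_iff_left]
    rcases hk with hki | hjk
    · have hj : 1 ≤ a j - x := by linarith [hright j (hki.trans_lt hij)]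
      rcases hki.eq_or_lt with rfl | hki
      · calc (x - a k) * (a j - x) ≤ (x - a k) * (a j - a k) := by
              linarith [sq_nonneg (x - a k)]
          _ ≤ δ * (a j - a k) := mul_le_mul_of_nonneg_right hxr (sub_nonneg.2 (hmono hij.le))
          _ < t := hspread k j
      · have hi : x - a i ≤ 0 := by linarith [hright i hki]
        exact (mul_nonpos_of_nonpos_of_nonneg hi (by linarith)).trans_lt ht0
    · have hi : 1 ≤ x - a i := by linarith [hleft i (hij.trans_le hjk)]
      rcases hjk.eq_or_lt with rfl | hjk
      · calc (x - a i) * (a j - x) ≤ (a j - a i) * (a j - x) := by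
              linarith [sq_nonneg (a j - x)]
          _ ≤ (a j - a i) * δ :=
            mul_le_mul_of_nonneg_left (by linarith) (sub_nonneg.2 (hmono hij.le))
          _ < t := (mul_comm _ _).trans_lt (hspread i j)
      · have hj : a j - x ≤ 0 := by linarith [hleft j hjk]
        exact (mul_nonpos_of_nonneg_of_nonpos (by linarith) hj).trans_lt ht0

theorem pocket_subset_openPolygon
    (hmono : StrictMonoOn d.getVert (Iic (d.length - 1))) (hk : k ∈ d.support)
    (hl : ∃ l ∈ d.support, l < k) (hr : ∃ r ∈ d.support, k < r) :
    pocket a k ⊆ openPolygon (a ∘ d.getVert) (d.length - 1) := by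
  simp only [mem_support_iff_exists_getVert_le] at hk hl hr
  obtain ⟨j, hj, rfl⟩ := hk
  obtain ⟨_, ⟨l, hl, rfl⟩, hlj⟩ := hl
  obtain ⟨_, ⟨r, hr, rfl⟩, hjr⟩ := hr
  rintro p ⟨hbelow, habove⟩
  refine ⟨hbelow _ _ ?_ ?_, fun i hi => habove _ _ ?_ ?_⟩
  · exact (hmono.monotoneOn (Nat.zero_le _) hl l.zero_le).trans_lt hlj
  · exact hjr.trans_le (hmono.monotoneOn hr self_mem_Iic hr)
  · exact hmono hi.le hi i.lt_succ_self
  · rcases Nat.lt_or_ge i j with h | h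
    · exact .inr (hmono.monotoneOn hi hj h)
    · exact .inl (hmono.monotoneOn hj hi.le h)

theorem exists_retraces_of_isPlaneCycle (hmono : StrictMono a)
    (hc : (chordDrawing a ha).IsPlaneCycle c) :
    ∃ (u : V) (d : (⊤ : SimpleGraph V).Walk u u), Retraces d c ∧
      StrictMonoOn d.getVert (Iic (d.length - 1)) := by
  refine exists_retraces_strictMonoOn hc.1 fun i k j l hik hkj hjl hij hkl => hc.2 _ hij _ hkl ?_
  exact (cross_chordDrawing_iff hmono (hik.trans hkj) (hkj.trans hjl)).2 (.inl ⟨hik, hkj, hjl⟩)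

theorem pocket_subset_of_isFaceOf (hmono : StrictMono a) {F : Set (ℝ × ℝ)}
    (hF : (chordDrawing a ha).IsFaceOf c F) (hk : k ∈ c.support) (hl : ∃ l ∈ c.support, l < k)
    (hr : ∃ r ∈ c.support, k < r) : pocket a k ⊆ F := by
  obtain ⟨hc, hbdd, x, hx, rfl⟩ := hF
  obtain ⟨u, d, hdc, hd⟩ := exists_retraces_of_isPlaneCycle hmono hc
  have hcyc := hdc.isCycle hc.1
  simp only [← hdc.mem_support_iff] at hk hl hr
  have hpoly : (chordDrawing a ha).trace c = closedPolygon (a ∘ d.getVert) (d.length - 1) \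
      openPolygon (a ∘ d.getVert) (d.length - 1) := by
    rw [closedPolygon_sdiff_openPolygon (by have := hcyc.three_le_length; omega)
      (hmono.comp_strictMonoOn hd), ← hdc.trace_eq (chordDrawing a ha)]
    exact trace_eq_union_iUnion (chordDrawing a ha) hcyc.not_nil
  rw [hpoly] at hbdd hx ⊢
  exact (pocket_subset_openPolygon hd hk hl hr).trans <|
    subset_connectedComponentIn_compl_diff_of_convex convex_closedPolygon convex_openPolygon
      openPolygon_subset_closedPolygon hx hbdd

theorem exists_intermediate_of_isPlaneCycle (hmono : StrictMono a)
    (hc : (chordDrawing a ha).IsPlaneCycle c) :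
    ∃ k ∈ c.support, (∃ l ∈ c.support, l < k) ∧ ∃ r ∈ c.support, k < r := by
  obtain ⟨u, d, hdc, hd⟩ := exists_retraces_of_isPlaneCycle hmono hc
  have hlen := (hdc.isCycle hc.1).three_le_length
  simp only [← hdc.mem_support_iff]
  exact ⟨_, d.getVert_mem_support 1, ⟨_, d.getVert_mem_support 0, hd (by grind) (by grind) one_pos⟩,
    _, d.getVert_mem_support 2, hd (by grind) (by grind) one_lt_two⟩

end Pocket

section Deformation

open Filter in
theorem surjective_id_add {g : ℝ → ℝ} (hg : Monotone g) (hc : Continuous g) :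
    Function.Surjective fun x => x + g x := by
  refine (continuous_id.add hc).surjective
    (tendsto_atTop_mono' _ ?_ (tendsto_atTop_add_const_right _ (g 0) tendsto_id))
    (tendsto_atBot_mono' _ ?_ (tendsto_atBot_add_const_right _ (g 0) tendsto_id))
  · filter_upwards [eventually_ge_atTop 0] with x hx using add_le_add_right (hg hx) x
  · filter_upwards [eventually_le_atBot 0] with x hx using add_le_add_right (hg hx) x

/-- The order isomorphism `x ↦ x + g x` of the real line, for a continuous monotone function `g`. -/
noncomputable def idAddOrderIso (g : ℝ → ℝ) (hg : Monotone g) (hc : Continuous g) : ℝ ≃o ℝ :=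
  StrictMono.orderIsoOfSurjective (fun x => x + g x) (strictMono_id.add_monotone hg)
    (surjective_id_add hg hc)

/-- The map `(x, y) ↦ (U x, (U x) ^ 2 + Ψ y)`, which carries the horizontal axis to the parabola
`y = x ^ 2`. -/
def parabolicShear (U Ψ : ℝ ≃o ℝ) : (ℝ × ℝ) ≃ₜ (ℝ × ℝ) where
  toFun p := (U p.1, U p.1 ^ 2 + Ψ p.2)
  invFun q := (U.symm q.1, Ψ.symm (q.2 - q.1 ^ 2))
  left_inv p := by simp
  right_inv q := by simp
  continuous_toFun := by
    have hU := U.continuous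
    have hΨ := Ψ.continuous
    fun_prop
  continuous_invFun := by
    have hU := U.symm.continuous
    have hΨ := Ψ.symm.continuous
    fun_prop

end Deformation

section SquareDrawing

variable {n : ℕ} {x y : ℝ}

/-- The abscissa of the `k`-th vertex, the midpoint of the `k`-th of the `n` equal parts of the unit
interval. -/
noncomputable def columnCenter (k : Fin n) : ℝ := (k + 1 / 2) / n

/-- The order isomorphism of the real line that increases with slope `1`, except for a jump by `1`,
made continuous, around each of the points `1 / n`, `2 / n`, ..., `1`. -/
noncomputable def staircase (n : ℕ) : ℝ ≃o ℝ :=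
  idAddOrderIso (fun x => ∑ j ∈ Finset.range n, max 0 (min 1 (3 * (n * x - j) - 5 / 2)))
    (fun x y hxy => Finset.sum_le_sum fun j _ => by gcongr) (by fun_prop)

theorem staircase_of_abs_sub_le {k : Fin n} (hx : |x - columnCenter k| ≤ 1 / (3 * n)) :
    staircase n x = x + k := by
  have hn : (0 : ℝ) < n := Nat.cast_pos.2 k.pos
  have hcenter : n * columnCenter k = k + 1 / 2 := mul_div_cancel₀ _ hn.ne'
  have hwidth : n * (1 / (3 * n)) = (1 / 3 : ℝ) := by field_simp
  have hl : n * (columnCenter k - x) ≤ n * (1 / (3 * n)) := by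
    gcongr
    linarith [neg_le_of_abs_le hx]
  have hr : n * (x - columnCenter k) ≤ n * (1 / (3 * n)) := by
    gcongr
    exact le_of_abs_le hx
  have hterm (j : ℕ) :
      max 0 (min 1 (3 * (n * x - j) - 5 / 2)) = if j < k then (1 : ℝ) else 0 := by
    split_ifs with hjk
    · have hjk : (j : ℝ) + 1 ≤ k := mod_cast hjk
      rw [min_eq_left (by linarith), max_eq_right zero_le_one]
    · have hjk : (k : ℝ) ≤ j := mod_cast not_lt.1 hjk
      exact max_eq_left ((min_le_right _ _).trans (by linarith))
  have hfilter : (Finset.range n).filter (· < (k : ℕ)) = Finset.range k := by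
    ext
    simp
    omega
  change x + ∑ j ∈ Finset.range n, max 0 (min 1 (3 * (n * x - j) - 5 / 2)) = x + k
  simp only [hterm, Finset.sum_boole, hfilter, Finset.card_range]

/-- The order isomorphism of the real line that is the identity up to `7 / 8` and is then so steep
that it maps `1` above `n ^ 2`. -/
noncomputable def steepening (n : ℕ) : ℝ ≃o ℝ :=
  idAddOrderIso (fun y => 8 * n ^ 2 * max 0 (y - 7 / 8))
    (fun x y hxy => by beta_reduce; gcongr) (by fun_prop)

theorem steepening_apply (n : ℕ) (y : ℝ) :
    steepening n y = y + 8 * n ^ 2 * max 0 (y - 7 / 8) := rfl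

theorem steepening_of_le (hy : y ≤ 7 / 8) : steepening n y = y := by
  simp [steepening_apply, hy]

theorem sq_le_steepening_one (n : ℕ) : (n : ℝ) ^ 2 ≤ steepening n 1 := by
  rw [steepening_apply, max_eq_right (by norm_num)]
  linarith

/-- The abscissa on the parabola to which `staircase` moves the `k`-th vertex. -/
noncomputable def parabolaAbscissa (k : Fin n) : ℝ := staircase n (columnCenter k)

theorem strictMono_columnCenter : StrictMono (columnCenter (n := n)) := by
  intro i j hij
  have hn : (0 : ℝ) < n := Nat.cast_pos.2 i.pos
  have hij : (i : ℝ) < j := mod_cast hij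
  unfold columnCenter
  gcongr

theorem strictMono_parabolaAbscissa : StrictMono (parabolaAbscissa (n := n)) :=
  (staircase n).strictMono.comp strictMono_columnCenter

theorem columnCenter_mem_Icc (k : Fin n) : columnCenter k ∈ Icc (0 : ℝ) 1 := by
  have hk : (k : ℝ) + 1 ≤ n := mod_cast k.isLt
  have hn : (0 : ℝ) < n := Nat.cast_pos.2 k.pos
  exact ⟨by unfold columnCenter; positivity, (div_le_one hn).2 (by linarith)⟩

theorem parabolaAbscissa_eq (k : Fin n) : parabolaAbscissa k = columnCenter k + k :=
  staircase_of_abs_sub_le (by simp)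

theorem parabolaAbscissa_mem_Icc (k : Fin n) : parabolaAbscissa k ∈ Icc (0 : ℝ) n := by
  have hk : (k : ℝ) + 1 ≤ n := mod_cast k.isLt
  obtain ⟨h0, h1⟩ := columnCenter_mem_Icc k
  rw [parabolaAbscissa_eq]
  exact ⟨by positivity, by linarith⟩

theorem parabolaAbscissa_sub_le (i j : Fin n) : parabolaAbscissa j - parabolaAbscissa i ≤ n := by
  linarith [(parabolaAbscissa_mem_Icc i).1, (parabolaAbscissa_mem_Icc j).2]

theorem columnCenter_add_le {i j : Fin n} (hij : i < j) :
    columnCenter i + 1 / n ≤ columnCenter j := by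
  have hij : (i : ℝ) + 1 ≤ j := mod_cast hij
  rw [columnCenter, columnCenter, ← add_div]
  gcongr ?_ / _
  linarith

/-- The drawing `D_n` of the theorem: the complete graph on `n` points of the parabola, pulled back
to the unit square by a deformation that makes the pockets of all vertices thick. -/
noncomputable def squareDrawing (n : ℕ) : TopologicalGraph (⊤ : SimpleGraph (Fin n)) :=
  (chordDrawing parabolaAbscissa strictMono_parabolaAbscissa.injective).comap
    (parabolicShear (staircase n) (steepening n))

theorem preimage_chord_subset_unitSquare (i j : Fin n) :
    parabolicShear (staircase n) (steepening n) ⁻¹'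
      chord (parabolaAbscissa i) (parabolaAbscissa j) ⊆ Icc (0 : ℝ) 1 ×ˢ Icc (0 : ℝ) 1 := by
  wlog hij : i ≤ j generalizing i j
  · rw [chord_comm]
    exact this j i (le_of_not_ge hij)
  intro p hp
  set u := staircase n p.1
  obtain ⟨hsq, heq⟩ := mem_chord.1 hp
  obtain ⟨hiu, huj⟩ : u ∈ Icc (parabolaAbscissa i) (parabolaAbscissa j) :=
    (sq_le_chordLine_iff (strictMono_parabolaAbscissa.monotone hij)).1 (heq ▸ hsq)
  have hheight : steepening n p.2 = (u - parabolaAbscissa i) * (parabolaAbscissa j - u) :=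
    add_left_cancel (heq.trans (chordLine_eq _ _ _))
  have hnonneg : steepening n 0 ≤ steepening n p.2 := by
    rw [hheight, steepening_of_le (by norm_num)]
    exact mul_nonneg (sub_nonneg.2 hiu) (sub_nonneg.2 huj)
  have hle : steepening n p.2 ≤ steepening n 1 := by
    refine le_trans ?_ (sq_le_steepening_one n)
    have hspread := parabolaAbscissa_sub_le i j
    rw [hheight, sq]
    gcongr <;> linarith
  refine ⟨⟨?_, ?_⟩, (steepening n).le_iff_le.1 hnonneg, (steepening n).le_iff_le.1 hle⟩
  · exact (columnCenter_mem_Icc i).1.trans ((staircase n).le_iff_le.1 hiu)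
  · exact ((staircase n).le_iff_le.1 huj).trans (columnCenter_mem_Icc j).2

theorem inUnitSquare_squareDrawing : (squareDrawing n).InUnitSquare := by
  refine ⟨fun v => preimage_chord_subset_unitSquare v v ?_, fun e _ => ?_⟩
  · rw [mem_preimage, mem_chord]
    simp [squareDrawing, TopologicalGraph.comap, chordDrawing, chordLine_left_self]
  · induction e with | _ i j
    exact preimage_chord_subset_unitSquare i j

/-- The rectangle in the face of every plane cycle that has `k` as an intermediate vertex. The
chords that end in the vertex `k` stay below the height `1 / 3` over it, those that pass over `k`
stay above the height `1`. -/
def vertexRectangle (k : Fin n) : Set (ℝ × ℝ) :=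
  Icc (columnCenter k - 1 / (3 * n)) (columnCenter k + 1 / (3 * n)) ×ˢ Icc (3 / 8) (7 / 8)

theorem isClosedRectangle_vertexRectangle (k : Fin n) : IsClosedRectangle (vertexRectangle k) := by
  have hn : (0 : ℝ) < n := Nat.cast_pos.2 k.pos
  have hw : (0 : ℝ) < 1 / (3 * n) := by positivity
  exact ⟨_, _, _, _, by linarith, by norm_num, rfl⟩

theorem volume_vertexRectangle (k : Fin n) :
    volume (vertexRectangle k) = ENNReal.ofReal (1 / (3 * n)) := by
  rw [vertexRectangle, Measure.volume_eq_prod, Measure.prod_prod, Real.volume_Icc, Real.volume_Icc,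
    ← ENNReal.ofReal_mul' (by norm_num)]
  congr 1
  ring

theorem disjoint_vertexRectangle {i j : Fin n} (hij : i ≠ j) :
    Disjoint (vertexRectangle i) (vertexRectangle j) := by
  wlog hlt : i < j generalizing i j
  · exact (this hij.symm (hij.symm.lt_of_le (not_lt.1 hlt))).symm
  have hn : (0 : ℝ) < n := Nat.cast_pos.2 i.pos
  have hgap := columnCenter_add_le hlt
  have hw : (1 : ℝ) / (3 * n) + 1 / (3 * n) < 1 / n := by
    rw [← two_mul]
    field_simp
    norm_num
  refine disjoint_left.2 fun p hi hj => ?_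
  linarith [hi.1.2, hj.1.1]

theorem vertexRectangle_subset_preimage_pocket (k : Fin n) :
    vertexRectangle k ⊆
      parabolicShear (staircase n) (steepening n) ⁻¹' pocket parabolaAbscissa k := by
  rintro ⟨x, y⟩ ⟨⟨hxl, hxr⟩, hyl, hyr⟩
  dsimp only at hxl hxr hyl hyr
  have hn : (0 : ℝ) < n := Nat.cast_pos.2 k.pos
  have hx : |x - columnCenter k| ≤ 1 / (3 * n) := abs_le.2 ⟨by linarith, by linarith⟩
  have hgap : (1 : ℝ) / (3 * n) ≤ 1 / n := by
    gcongr
    linarith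
  have hwidth : 1 / (3 * n) * n = (1 / 3 : ℝ) := by field_simp
  change (staircase n x, staircase n x ^ 2 + steepening n y) ∈ pocket parabolaAbscissa k
  rw [staircase_of_abs_sub_le hx, steepening_of_le hyr]
  refine mem_pocket strictMono_parabolaAbscissa.monotone (fun i hik => ?_) (fun j hkj => ?_) ?_
    parabolaAbscissa_sub_le (δ := 1 / (3 * n)) (by linarith) (by linarith)
  · have hik' : (i : ℝ) + 1 ≤ k := mod_cast hik
    rw [parabolaAbscissa_eq]
    linarith [columnCenter_add_le hik]
  · have hkj' : (k : ℝ) + 1 ≤ j := mod_cast hkj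
    rw [parabolaAbscissa_eq]
    linarith [columnCenter_add_le hkj]
  · rwa [parabolaAbscissa_eq, add_sub_add_right_eq_sub]

theorem isSimple_squareDrawing : (squareDrawing n).IsSimple :=
  isSimple_chordDrawing.comap

theorem cross_squareDrawing_iff {i j k l : Fin n} (hij : i < j) (hkl : k < l) :
    (squareDrawing n).Cross s(i, j) s(k, l) ↔
      (i < k ∧ k < j ∧ j < l) ∨ (k < i ∧ i < l ∧ l < j) :=
  TopologicalGraph.cross_comap.trans (cross_chordDrawing_iff strictMono_parabolaAbscissa hij hkl)

variable {v : Fin n} {c : (⊤ : SimpleGraph (Fin n)).Walk v v}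

theorem visitsInIncreasingOrder_of_isPlaneCycle (hc : (squareDrawing n).IsPlaneCycle c) :
    VisitsInIncreasingOrder c := by
  obtain ⟨u, d, hdc, hd⟩ := exists_retraces_of_isPlaneCycle strictMono_parabolaAbscissa
    (TopologicalGraph.isPlaneCycle_comap.1 hc)
  exact hdc.visitsInIncreasingOrder hd

theorem vertexRectangle_subset_of_isFaceOf {F : Set (ℝ × ℝ)} (hF : (squareDrawing n).IsFaceOf c F)
    {k : Fin n} (hk : k ∈ c.support) (hl : ∃ l ∈ c.support, l < k) (hr : ∃ r ∈ c.support, k < r) :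
    vertexRectangle k ⊆ F := by
  refine (vertexRectangle_subset_preimage_pocket k).trans ?_
  rw [← preimage_image_eq F (parabolicShear (staircase n) (steepening n)).injective]
  exact preimage_mono (pocket_subset_of_isFaceOf strictMono_parabolaAbscissa hF.image hk hl hr)

theorem ofReal_le_volume_of_generatesFace {F : Set (ℝ × ℝ)}
    (hF : (squareDrawing n).GeneratesFace F) : ENNReal.ofReal (1 / (3 * n)) ≤ volume F := by
  obtain ⟨v, c, hF⟩ := hF
  obtain ⟨k, hk, hl, hr⟩ := exists_intermediate_of_isPlaneCycle strictMono_parabolaAbscissa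
    (TopologicalGraph.isPlaneCycle_comap.1 hF.1)
  rw [← volume_vertexRectangle k]
  exact measure_mono (vertexRectangle_subset_of_isFaceOf hF hk hl hr)

end SquareDrawing

theorem theorem3 :
    ∀ n : ℕ, 1 ≤ n →
      ∃ D : TopologicalGraph (⊤ : SimpleGraph (Fin n)),
        D.IsSimple ∧ D.InUnitSquare ∧
        -- every generated face has area at least `1 / (3 n)`
        (∀ F : Set (ℝ × ℝ), D.GeneratesFace F →
          ENNReal.ofReal (1 / (3 * (n : ℝ))) ≤ volume F) ∧
        -- the crossing pattern is that of points in convex position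
        (∀ i₁ i₂ i₃ i₄ : Fin n, i₁ < i₂ → i₃ < i₄ →
          (D.Cross s(i₁, i₂) s(i₃, i₄) ↔
            (i₁ < i₃ ∧ i₃ < i₂ ∧ i₂ < i₄) ∨ (i₃ < i₁ ∧ i₁ < i₄ ∧ i₄ < i₂))) ∧
        -- every plane cycle visits its vertices in increasing order
        (∀ (v : Fin n) (c : (⊤ : SimpleGraph (Fin n)).Walk v v),
          D.IsPlaneCycle c → VisitsInIncreasingOrder c) ∧
        -- the face of a plane cycle contains the rectangles of its intermediate vertices
        (∃ R : Fin n → Set (ℝ × ℝ),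
          (∀ i, IsClosedRectangle (R i) ∧ volume (R i) = ENNReal.ofReal (1 / (3 * (n : ℝ)))) ∧
          (∀ i j, i ≠ j → Disjoint (R i) (R j)) ∧
          ∀ (v : Fin n) (c : (⊤ : SimpleGraph (Fin n)).Walk v v) (F : Set (ℝ × ℝ)),
            D.IsFaceOf c F →
              ∀ i ∈ c.support, (∃ a ∈ c.support, a < i) → (∃ b ∈ c.support, i < b) →
                R i ⊆ F) := by
  intro n _
  refine ⟨squareDrawing n, isSimple_squareDrawing, inUnitSquare_squareDrawing, ?_, ?_, ?_, ?_⟩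
  · exact fun F => ofReal_le_volume_of_generatesFace
  · exact fun i₁ i₂ i₃ i₄ => cross_squareDrawing_iff
  · exact fun v c => visitsInIncreasingOrder_of_isPlaneCycle
  · refine ⟨vertexRectangle, fun i => ?_, fun i j => disjoint_vertexRectangle, fun v c F hF i => ?_⟩
    · exact ⟨isClosedRectangle_vertexRectangle i, volume_vertexRectangle i⟩
    · exact vertexRectangle_subset_of_isFaceOf hF
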